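/- Let $K$ be a field of characteristic $0$ (for instance $\mathbb R$ or $\mathbb C$), let $r$ be an integer, and for $k\ge 1$, $0\le i\le s_k$ let $p_i(k), r_{k,i}\in K$ be arbitrary. Let $H$ be the Hopf algebra of rooted trees decorated by pairs $(k,i)$ (as an algebra, the commutative polynomial algebra over $K$ on the decorated rooted trees), and let $B_+^{k,i}:H\to H$ be the linear map that joins the roots of the trees of a forest to a new root decorated by $(k,i)$. Let $X=X(x)\in H[[x]]$ be the solution of the Dyson–Schwinger equation $$X=\mathbb I-\sum_{k\ge 1}\sum_{i=0}^{s_k}x^k\,p_i(k)\,B_+^{k,i}(XQ^k),\qquad Q=X^r .$$ Let the Mellin transforms be $F_{k,i}(\rho)$ with $\rho F_{k,i}(\rho)=r_{k,i}/(1-\rho)$, and let the renormalized Feynman rules $\phi_R:H\to K[L]$ be the algebra homomorphism determined by $$\phi_R\big(B_+^{k,i}(h)\big)(L)=\phi_R(h)(\partial_{-\rho})\Big[F_{k,i}(\rho)\big(e^{-L\rho}-1\big)\Big]\Big|_{\rho=0},\qquad \partial_{-\rho}=-\frac{\partial}{\partial\rho}.$$ Write the Green function as $G(x,L)=\phi_R(X)=1+\sum_{k\ge1}\gamma_k(x)L^k$.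 Then the anomalous dimension $\gamma_1$ has no constant term, $\gamma_1(x)=\sum_{n\ge1}\gamma_{1,n}x^n$, and for all $n\ge 1$ $$\gamma_{1,n}=p(n)+\sum_{j=1}^{n-1}(-rj-1)\,\gamma_{1,j}\,\gamma_{1,n-j},\qquad\text{where } p(k)=\sum_{i=0}^{s_k}r_{k,i}\,p_i(k).$$ -/

import Mathlib

namespace DysonSchwinger

/-- Planar rooted trees with vertices decorated by `D`. -/
inductive PlanarTree (D : Type) : Type
  | node (d : D) (children : List (PlanarTree D)) : PlanarTree D

/-- The equivalence relation generated by permuting the branches at the vertices of a planar tree.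
Its classes are the (non-planar) decorated rooted trees. -/
inductive PlanarTree.Iso {D : Type} : PlanarTree D → PlanarTree D → Prop
  | refl (t : PlanarTree D) : Iso t t
  | symm {t u : PlanarTree D} : Iso t u → Iso u t
  | trans {t u v : PlanarTree D} : Iso t u → Iso u v → Iso t v
  | perm (d : D) {l l' : List (PlanarTree D)} : l.Perm l' → Iso (.node d l) (.node d l')
  | branch (d : D) (l₁ l₂ : List (PlanarTree D)) {t t' : PlanarTree D} :
      Iso t t' → Iso (.node d (l₁ ++ t :: l₂)) (.node d (l₁ ++ t' :: l₂))

instance PlanarTree.setoid (D : Type) : Setoid (PlanarTree D) where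
  r := PlanarTree.Iso
  iseqv := ⟨.refl, .symm, .trans⟩

/-- Decorated (non-planar) rooted trees. -/
abbrev RootedTree (D : Type) : Type := Quotient (PlanarTree.setoid D)

/-- The rooted tree whose root is decorated by `d` and whose branches form the forest `f`. -/
noncomputable def RootedTree.graft {D : Type} (d : D) (f : Multiset (RootedTree D)) :
    RootedTree D :=
  Quotient.mk _ (PlanarTree.node d (f.toList.map Quotient.out))

theorem PlanarTree.iso_node_of_forall₂ {D : Type} (d : D) {l l' : List (PlanarTree D)}
    (h : List.Forall₂ PlanarTree.Iso l l') :
    PlanarTree.Iso (.node d l) (.node d l') := by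
  suffices H : ∀ l₀ : List (PlanarTree D),
      PlanarTree.Iso (.node d (l₀ ++ l)) (.node d (l₀ ++ l')) by simpa using H []
  induction h with
  | nil => intro l₀; exact .refl _
  | @cons a b l l' hab _ ih =>
    intro l₀
    refine (PlanarTree.Iso.branch d l₀ l hab).trans ?_
    simpa using ih (l₀ ++ [b])

/-- `RootedTree.graft` is what it should be on representatives. -/
theorem RootedTree.graft_mk {D : Type} (d : D) (l : List (PlanarTree D)) :
    RootedTree.graft d (Multiset.ofList (l.map (Quotient.mk (PlanarTree.setoid D)))) =
      Quotient.mk _ (PlanarTree.node d l) := by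
  apply Quotient.sound
  have h1 : (Multiset.ofList (l.map (Quotient.mk (PlanarTree.setoid D)))).toList.Perm
      (l.map (Quotient.mk (PlanarTree.setoid D))) := by
    rw [← Multiset.coe_eq_coe, Multiset.coe_toList]
  refine (PlanarTree.Iso.perm d (h1.map Quotient.out)).trans ?_
  apply PlanarTree.iso_node_of_forall₂
  rw [List.map_map, List.forall₂_map_left_iff]
  exact List.forall₂_same.2 fun t _ => Quotient.mk_out (s := PlanarTree.setoid D) t

/-- Decorations: the pair `(k, i)` stands for the `i`-th primitive at loop order `k`. -/
abbrev Decoration : Type := ℕ × ℕ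

/-- The (commutative algebra underlying the) Hopf algebra of decorated rooted trees: polynomials in
the rooted trees; its monomials are the forests. -/
abbrev TreeAlgebra (K : Type*) [CommSemiring K] : Type _ := MvPolynomial (RootedTree Decoration) K

/-- The grafting operator `B₊^{k,i}`: it joins the roots of all trees of a forest to a new root
decorated by `(k, i)`, extended linearly. -/
noncomputable def bPlus (K : Type*) [CommSemiring K] (k i : ℕ) : TreeAlgebra K →ₗ[K] TreeAlgebra K :=
  (MvPolynomial.basisMonomials (RootedTree Decoration) K).constr K fun f =>
    MvPolynomial.X (RootedTree.graft (k, i) (Finsupp.toMultiset f))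

section DSE

variable {K : Type*} [Field K]

/-- The combinatorial Dyson–Schwinger equation
`X = 𝕀 - ∑_{k ≥ 1} ∑_{i = 0}^{s k} x^k p_i(k) B₊^{k,i}(X Q^k)` with `Q = X^r`, in formal power
series in `x` over the algebra of decorated rooted trees. It is written out coefficient by
coefficient, `B₊^{k,i}` acting on the coefficients; in degree `n` only `k ≤ n` contribute. -/
def IsDSESolution (r : ℤ) (s : ℕ → ℕ) (p : ℕ → ℕ → K) (X : (PowerSeries (TreeAlgebra K))ˣ) :
    Prop :=
  ∀ n : ℕ, PowerSeries.coeff n (X : PowerSeries (TreeAlgebra K)) =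
    PowerSeries.coeff n (1 : PowerSeries (TreeAlgebra K)) -
      ∑ k ∈ Finset.Icc 1 n, ∑ i ∈ Finset.range (s k + 1),
        p i k • bPlus K k i
          (PowerSeries.coeff (n - k) ((X * (X ^ r) ^ k : (PowerSeries (TreeAlgebra K))ˣ) :
            PowerSeries (TreeAlgebra K)))

/-- Truncated powers only depend on truncations. -/
theorem coeff_mul_zpow_congr {R : Type*} [CommRing R] (r : ℤ) (k m : ℕ) (Y Y' : (PowerSeries R)ˣ)
    (h : ∀ j < m, PowerSeries.coeff j (Y : PowerSeries R) = PowerSeries.coeff j (Y' : PowerSeries R))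
    (j : ℕ) (hj : j < m) :
    PowerSeries.coeff j ((Y * (Y ^ r) ^ k : (PowerSeries R)ˣ) : PowerSeries R) =
      PowerSeries.coeff j ((Y' * (Y' ^ r) ^ k : (PowerSeries R)ˣ) : PowerSeries R) := by
  let q := Ideal.Quotient.mk (Ideal.span {(PowerSeries.X : PowerSeries R) ^ m})
  have key : ∀ a b : PowerSeries R, q a = q b ↔
      ∀ j < m, PowerSeries.coeff j a = PowerSeries.coeff j b := fun a b => by
    rw [Ideal.Quotient.eq, Ideal.mem_span_singleton, PowerSeries.X_pow_dvd_iff]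
    simp only [map_sub, sub_eq_zero]
  have hY : Units.map q.toMonoidHom Y = Units.map q.toMonoidHom Y' :=
    Units.ext ((key _ _).2 h)
  have hZ : Units.map q.toMonoidHom (Y * (Y ^ r) ^ k) =
      Units.map q.toMonoidHom (Y' * (Y' ^ r) ^ k) := by
    simp only [map_mul, map_pow, map_zpow, hY]
  exact (key _ _).1 (congrArg Units.val hZ) j hj

/-- The Dyson–Schwinger equation has exactly one solution. -/
theorem existsUnique_isDSESolution (r : ℤ) (s : ℕ → ℕ) (p : ℕ → ℕ → K) :
    ∃! X : (PowerSeries (TreeAlgebra K))ˣ, IsDSESolution r s p X := by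
  let S := PowerSeries (TreeAlgebra K)
  let t : Sˣ → S := fun Y => PowerSeries.mk fun n => PowerSeries.coeff n (1 : S) -
      ∑ k ∈ Finset.Icc 1 n, ∑ i ∈ Finset.range (s k + 1),
        p i k • bPlus K k i (PowerSeries.coeff (n - k) ((Y * (Y ^ r) ^ k : Sˣ) : S))
  have ht : ∀ Y, IsUnit (t Y) := fun Y => by
    rw [PowerSeries.isUnit_iff_constantCoeff, ← PowerSeries.coeff_zero_eq_constantCoeff_apply]
    simp [t]
  have agree : ∀ (m : ℕ) (Y Y' : Sˣ),
      (∀ j < m, PowerSeries.coeff j (Y : S) = PowerSeries.coeff j (Y' : S)) →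
      ∀ j < m + 1, PowerSeries.coeff j (t Y) = PowerSeries.coeff j (t Y') := by
    intro m Y Y' h j hj
    simp only [t, PowerSeries.coeff_mk]
    congr 1
    refine Finset.sum_congr rfl fun k hk => Finset.sum_congr rfl fun i _ => ?_
    rw [Finset.mem_Icc] at hk
    rw [coeff_mul_zpow_congr r k m Y Y' h (j - k) (by omega)]
  have sol : ∀ X : Sˣ, IsDSESolution r s p X ↔
      ∀ n, PowerSeries.coeff n (X : S) = PowerSeries.coeff n (t X) := fun X => by
    simp only [IsDSESolution, t, PowerSeries.coeff_mk, S]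
  obtain ⟨y, y_succ⟩ : ∃ y : ℕ → Sˣ, ∀ m, (y (m + 1)).val = t (y m) :=
    ⟨fun m => Nat.rec 1 (fun _ Y => (ht Y).unit) m, fun _ => rfl⟩
  have step : ∀ m, ∀ j < m, PowerSeries.coeff j (y m).val = PowerSeries.coeff j (y (m + 1)).val := by
    intro m
    induction m with
    | zero => intro j hj; omega
    | succ m ih => intro j hj; rw [y_succ, y_succ]; exact agree m _ _ ih j hj
  have stable : ∀ m l, m ≤ l → ∀ j < m,
      PowerSeries.coeff j (y m).val = PowerSeries.coeff j (y l).val := by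
    intro m l hml
    induction l, hml using Nat.le_induction with
    | base => intro j _; rfl
    | succ l hl ih => intro j hj; rw [ih j hj, step l j (by omega)]
  let x : S := PowerSeries.mk fun n => PowerSeries.coeff n (y (n + 1)).val
  have hx : ∀ m, ∀ j < m, PowerSeries.coeff j x = PowerSeries.coeff j (y m).val := by
    intro m j hj
    simp only [x, PowerSeries.coeff_mk]
    exact stable (j + 1) m hj j (by omega)
  have hu : IsUnit x := by
    rw [PowerSeries.isUnit_iff_constantCoeff, ← PowerSeries.coeff_zero_eq_constantCoeff_apply,
      hx (0 + 1) 0 (by omega), y_succ 0, PowerSeries.coeff_zero_eq_constantCoeff_apply,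
      ← PowerSeries.isUnit_iff_constantCoeff]
    exact ht _
  refine ⟨hu.unit, (sol _).2 fun n => ?_, fun X' hX' => ?_⟩
  · rw [IsUnit.unit_spec, hx (n + 1) n (by omega), y_succ]
    exact (agree n hu.unit (y n) (fun j hj => hx n j hj) n (by omega)).symm
  · have hX : ∀ m, ∀ j < m, PowerSeries.coeff j (X' : S) = PowerSeries.coeff j (y m).val := by
      intro m
      induction m with
      | zero => intro j hj; omega
      | succ m ih =>
        intro j hj
        rw [(sol X').1 hX' j, y_succ]
        exact agree m _ _ ih j hj
    refine Units.ext (PowerSeries.ext fun n => ?_)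
    rw [IsUnit.unit_spec, hx (n + 1) n (by omega), hX (n + 1) n (by omega)]

/-- The series `e^{-Lρ}` in `ρ`, with coefficients in `K[L]`. -/
noncomputable def expNegL (K : Type*) [Field K] : LaurentSeries (Polynomial K) :=
  HahnSeries.ofPowerSeries ℤ (Polynomial K)
    (PowerSeries.mk fun n => ((n.factorial : K)⁻¹) • (-Polynomial.X) ^ n)

/-- For a Mellin transform `F(ρ)`, the map taking `a(L)` to
`a(∂_{-ρ}) [F(ρ) (e^{-Lρ} - 1)] |_{ρ = 0}`, where `∂_{-ρ} = -∂/∂ρ`. -/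
noncomputable def insertion (F : LaurentSeries K) : Polynomial K →ₗ[K] Polynomial K where
  toFun a :=
    (Polynomial.aeval (-(LaurentSeries.derivative K) : Module.End K (LaurentSeries (Polynomial K))) a
      (F.map (Polynomial.C : K →+* Polynomial K) * (expNegL K - 1))).coeff 0
  map_add' a b := by simp
  map_smul' c a := by simp

mutual
/-- Renormalized Feynman rules on planar trees: a tree with root `(k, i)` is sent to the insertion
of the product of the values of its branches into the kernel with Mellin transform `F k i`. -/
noncomputable def planarRules (F : ℕ → ℕ → LaurentSeries K) :
    PlanarTree Decoration → Polynomial K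
  | .node d l => insertion (F d.1 d.2) (planarRulesList F l)

/-- The product of the Feynman rules over a list of planar trees. -/
noncomputable def planarRulesList (F : ℕ → ℕ → LaurentSeries K) :
    List (PlanarTree Decoration) → Polynomial K
  | [] => 1
  | t :: l => planarRules F t * planarRulesList F l
end

theorem planarRulesList_eq (F : ℕ → ℕ → LaurentSeries K) (l : List (PlanarTree Decoration)) :
    planarRulesList F l = (l.map (planarRules F)).prod := by
  induction l with
  | nil => simp [planarRulesList]
  | cons t l ih => simp [planarRulesList, ih]

theorem planarRules_iso (F : ℕ → ℕ → LaurentSeries K) {t u : PlanarTree Decoration}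
    (h : PlanarTree.Iso t u) : planarRules F t = planarRules F u := by
  induction h with
  | refl => rfl
  | symm _ ih => exact ih.symm
  | trans _ _ ih₁ ih₂ => exact ih₁.trans ih₂
  | perm d h =>
    simp only [planarRules, planarRulesList_eq]
    rw [(h.map _).prod_eq]
  | branch d l₁ l₂ _ ih =>
    simp only [planarRules, planarRulesList_eq, List.map_append, List.map_cons, ih]

/-- The renormalized Feynman rules `φ_R` for the Mellin transforms `F k i`: the algebra map from
decorated rooted trees to polynomials in `L` (see `feynmanRules_bPlus` for its defining property). -/
noncomputable def feynmanRules (F : ℕ → ℕ → LaurentSeries K) :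
    TreeAlgebra K →ₐ[K] Polynomial K :=
  MvPolynomial.aeval (Quotient.lift (planarRules F) fun _ _ h => planarRules_iso F h)

theorem feynmanRules_graft (F : ℕ → ℕ → LaurentSeries K) (k i : ℕ)
    (f : Multiset (RootedTree Decoration)) :
    feynmanRules F (MvPolynomial.X (RootedTree.graft (k, i) f)) =
      insertion (F k i) (f.map fun t => feynmanRules F (MvPolynomial.X t)).prod := by
  have hf : f = Multiset.ofList ((f.toList.map Quotient.out).map
      (Quotient.mk (PlanarTree.setoid Decoration))) := by
    rw [List.map_map]
    conv_lhs => rw [← Multiset.coe_toList f]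
    congr 1
    conv_lhs => rw [← List.map_id f.toList]
    exact List.map_congr_left fun t _ => (Quotient.out_eq t).symm
  rw [hf, RootedTree.graft_mk, Multiset.map_coe, Multiset.prod_coe]
  simp only [feynmanRules, MvPolynomial.aeval_X, Quotient.lift_mk, planarRules, planarRulesList_eq,
    List.map_map]
  rfl

/-- `φ_R(B₊^{k,i}(h))(L) = φ_R(h)(∂_{-ρ}) [F_{k,i}(ρ) (e^{-Lρ} - 1)] |_{ρ = 0}`. -/
theorem feynmanRules_bPlus (F : ℕ → ℕ → LaurentSeries K) (k i : ℕ) (h : TreeAlgebra K) :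
    feynmanRules F (bPlus K k i h) = insertion (F k i) (feynmanRules F h) := by
  suffices H : (feynmanRules F).toLinearMap ∘ₗ bPlus K k i =
      insertion (F k i) ∘ₗ (feynmanRules F).toLinearMap from LinearMap.congr_fun H h
  refine (MvPolynomial.basisMonomials (RootedTree Decoration) K).ext fun f => ?_
  simp only [LinearMap.comp_apply, bPlus, Module.Basis.constr_basis, AlgHom.toLinearMap_apply,
    feynmanRules_graft]
  congr 1
  rw [MvPolynomial.coe_basisMonomials]
  simp only [MvPolynomial.monomial_eq, MvPolynomial.C_1, one_mul, map_finsuppProd, map_pow]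
  rw [Finsupp.toMultiset_map, Finsupp.prod_toMultiset]
  exact Finsupp.prod_mapDomain_index (fun _ => pow_zero _) fun _ _ _ => pow_add _ _ _

/-- The Green function `G(x, L) = φ_R(X)`, a power series in `x` over `K[L]`. -/
noncomputable def greenFunction (F : ℕ → ℕ → LaurentSeries K)
    (X : (PowerSeries (TreeAlgebra K))ˣ) : PowerSeries (Polynomial K) :=
  PowerSeries.map (feynmanRules F : TreeAlgebra K →+* Polynomial K) X

/-- The series `γ_k(x)` in `G(x, L) = 1 + ∑_{k ≥ 1} γ_k(x) L^k`. -/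
noncomputable def gamma (F : ℕ → ℕ → LaurentSeries K) (X : (PowerSeries (TreeAlgebra K))ˣ) (k : ℕ) :
    PowerSeries K :=
  PowerSeries.mk fun n => (PowerSeries.coeff n (greenFunction F X)).coeff k

end DSE

end DysonSchwinger

/-
Since `ρ F(ρ) = c / (1 - ρ)`, the kernel `F(ρ) (e^{-Lρ} - 1)` is sent to `-c e^{-Lρ}` by
`∂_L + ∂_L²`, so this operator inverts every insertion up to the factor `-c`. The Feynman rules thus
turn the Dyson–Schwinger equation into the differential equation `(∂_L + ∂_L²) G = G P(x G^r)` with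
`G(x, 0) = 1`, where `P(x) = ∑ p(k) x^k`.

The renormalization group operator `T = ∂_L - γ₁(x) (1 + r x ∂_x)` commutes with `∂_L` and maps
`G P(x G^r)` to `T G` times a series divisible by `x`. Hence `T G` solves a linear equation whose
only solution vanishing at `L = 0` is `0`, which gives `T G = 0`. Applying `∂_L` to `T G = 0` and
setting `L = 0` expresses `∂_L² G` at `L = 0` through `γ₁`, and the differential equation at `L = 0`
becomes `γ₁ + γ₁ (1 + r x d/dx) γ₁ = P(x)`, whose coefficients are the recursion.
-/

namespace DysonSchwinger

open PowerSeries (coeff constantCoeff)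
open scoped Polynomial PowerSeries

section Derivations

variable {R A : Type*} [CommRing R] [CommRing A] [Algebra R A]

theorem derivation_units_zpow (D : Derivation R A A) (u : Aˣ) (m : ℤ) :
    D ↑(u ^ m) * u = m * ↑(u ^ m) * D u := by
  induction m with
  | zero => simp
  | succ m ih =>
    rw [zpow_add_one, Units.val_mul, D.leibniz, smul_eq_mul, smul_eq_mul]
    push_cast at ih ⊢
    linear_combination (u : A) * ih
  | pred m ih =>
    have hu : u ^ (-m : ℤ) = u ^ (-m - 1 : ℤ) * u := by rw [← zpow_add_one, sub_add_cancel]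
    rw [hu, Units.val_mul, D.leibniz, smul_eq_mul, smul_eq_mul] at ih
    refine u.isUnit.mul_left_cancel ?_
    push_cast at ih ⊢
    linear_combination ih

/-- The derivation of `A⟦X⟧` acting on coefficients by a derivation `D` of `A`. -/
noncomputable def coeffwiseDerivation (D : Derivation R A A) : Derivation R A⟦X⟧ A⟦X⟧ :=
  Derivation.mk'
    { toFun := fun f => PowerSeries.mk fun n => D (coeff n f)
      map_add' := fun f g => by ext n; simp
      map_smul' := fun c f => by ext n; simp }
    fun f g => by
      ext n
      simp only [LinearMap.coe_mk, AddHom.coe_mk, smul_eq_mul, map_add,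
        PowerSeries.coeff_mk, mul_comm g, PowerSeries.coeff_mul, map_sum, Derivation.leibniz,
        Finset.sum_add_distrib]
      simp only [mul_comm]

@[simp]
theorem coeff_coeffwiseDerivation (D : Derivation R A A) (f : A⟦X⟧) (n : ℕ) :
    coeff n (coeffwiseDerivation D f) = D (coeff n f) :=
  PowerSeries.coeff_mk n fun n => D (coeff n f)

/-- The Euler operator `x d/dx` on power series. -/
noncomputable def euler (A : Type*) [CommRing A] : Derivation A A⟦X⟧ A⟦X⟧ :=
  (PowerSeries.X : A⟦X⟧) • PowerSeries.derivative A

@[simp]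
theorem coeff_euler (f : A⟦X⟧) (n : ℕ) : coeff n (euler A f) = n * coeff n f := by
  cases n with
  | zero => simp [euler]
  | succ n => simp [euler, PowerSeries.coeff_succ_X_mul, PowerSeries.coeff_derivative, mul_comm]

theorem map_euler {B : Type*} [CommRing B] (φ : A →+* B) (f : A⟦X⟧) :
    PowerSeries.map φ (euler A f) = euler B (PowerSeries.map φ f) := by
  ext n
  simp

theorem coeffwiseDerivation_euler (D : Derivation R A A) (f : A⟦X⟧) :
    coeffwiseDerivation D (euler A f) = euler A (coeffwiseDerivation D f) := by
  ext n
  simp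

theorem coeffwiseDerivation_map_algebraMap (D : Derivation R A A) (f : R⟦X⟧) :
    coeffwiseDerivation D (PowerSeries.map (algebraMap R A) f) = 0 := by
  ext n
  simp

end Derivations

section Substitution

variable {R A : Type*} [CommRing R] [CommRing A] [Algebra R A]

theorem hasSubst_of_X_dvd {y : A⟦X⟧} (hy : PowerSeries.X ∣ y) : PowerSeries.HasSubst y :=
  PowerSeries.HasSubst.of_constantCoeff_zero' (PowerSeries.X_dvd_iff.1 hy)

theorem exists_eq_C_add_X_mul (P : R⟦X⟧) :
    ∃ (c : R) (Q : R⟦X⟧), P = PowerSeries.C c + PowerSeries.X * Q :=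
  ⟨_, _, (PowerSeries.eq_X_mul_shift_add_const P).trans (add_comm _ _)⟩

theorem subst_C_add_X_mul {y : A⟦X⟧} (hy : PowerSeries.HasSubst y) (c : R) (Q : R⟦X⟧) :
    (PowerSeries.C c + PowerSeries.X * Q).subst y = algebraMap R A⟦X⟧ c + y * Q.subst y := by
  have hC : (PowerSeries.C c).subst y = algebraMap R A⟦X⟧ c := by
    rw [← PowerSeries.coe_substAlgHom hy, ← PowerSeries.algebraMap_eq, AlgHom.commutes]
  rw [PowerSeries.subst_add hy, PowerSeries.subst_mul hy, PowerSeries.subst_X hy, hC]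

theorem X_dvd_subst {y : A⟦X⟧} (hy : PowerSeries.X ∣ y) {P : R⟦X⟧} (hP : constantCoeff P = 0) :
    PowerSeries.X ∣ P.subst y :=
  PowerSeries.X_dvd_iff.2
    (PowerSeries.constantCoeff_subst_eq_zero (PowerSeries.X_dvd_iff.1 hy) P hP)

theorem eq_of_forall_X_pow_dvd_sub {f g : A⟦X⟧} (h : ∀ n, PowerSeries.X ^ n ∣ f - g) : f = g := by
  ext n
  rw [← sub_eq_zero, ← map_sub]
  exact PowerSeries.X_pow_dvd_iff.1 (h (n + 1)) n n.lt_succ_self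

/-- In place of continuity of `φ`, Horner's scheme: peeling off one factor `y` at a time shows that
the two sides agree modulo every power of `X`. -/
theorem algHom_subst {B : Type*} [CommRing B] [Algebra R B] (φ : A⟦X⟧ →ₐ[R] B⟦X⟧) {y : A⟦X⟧}
    (hy : PowerSeries.X ∣ y) (hφy : PowerSeries.X ∣ φ y) (P : R⟦X⟧) :
    φ (P.subst y) = P.subst (φ y) := by
  refine eq_of_forall_X_pow_dvd_sub fun n => ?_
  induction n generalizing P with
  | zero => simp
  | succ n ih =>
    obtain ⟨c, Q, rfl⟩ := exists_eq_C_add_X_mul P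
    have hHorner : φ ((PowerSeries.C c + PowerSeries.X * Q).subst y) -
        (PowerSeries.C c + PowerSeries.X * Q).subst (φ y) =
          φ y * (φ (Q.subst y) - Q.subst (φ y)) := by
      rw [subst_C_add_X_mul (hasSubst_of_X_dvd hy), subst_C_add_X_mul (hasSubst_of_X_dvd hφy),
        map_add, map_mul, AlgHom.commutes]
      ring
    rw [hHorner, pow_succ']
    exact mul_dvd_mul hφy (ih Q)

theorem derivation_subst (D : Derivation R A⟦X⟧ A⟦X⟧) {y : A⟦X⟧} (hy : PowerSeries.X ∣ y)
    (P : R⟦X⟧) :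
    D (P.subst y) = (PowerSeries.derivative R P).subst y * D y := by
  have hs := hasSubst_of_X_dvd hy
  refine eq_of_forall_X_pow_dvd_sub fun n => ?_
  induction n generalizing P with
  | zero => simp
  | succ n ih =>
    obtain ⟨c, Q, rfl⟩ := exists_eq_C_add_X_mul P
    have hderiv : PowerSeries.derivative R (PowerSeries.C c + PowerSeries.X * Q) =
        Q + PowerSeries.X * PowerSeries.derivative R Q := by
      simp [add_comm]
    have hHorner : D ((PowerSeries.C c + PowerSeries.X * Q).subst y) -
        (PowerSeries.derivative R (PowerSeries.C c + PowerSeries.X * Q)).subst y * D y =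
          y * (D (Q.subst y) - (PowerSeries.derivative R Q).subst y * D y) := by
      rw [subst_C_add_X_mul hs, hderiv, PowerSeries.subst_add hs, PowerSeries.subst_mul hs,
        PowerSeries.subst_X hs, map_add, D.map_algebraMap, D.leibniz, smul_eq_mul, smul_eq_mul]
      ring
    rw [hHorner, pow_succ']
    exact mul_dvd_mul hy (ih Q)

theorem coeff_mul_subst_X_mul (h q : A⟦X⟧) (P : R⟦X⟧) (n : ℕ) :
    coeff n (h * P.subst (PowerSeries.X * q)) =
      ∑ k ∈ Finset.range (n + 1), coeff k P • coeff (n - k) (h * q ^ k) := by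
  have hs : PowerSeries.HasSubst (PowerSeries.X * q) := hasSubst_of_X_dvd (dvd_mul_right _ _)
  have hHorner (h : A⟦X⟧) (c : R) (Q : R⟦X⟧) :
      h * (PowerSeries.C c + PowerSeries.X * Q).subst (PowerSeries.X * q) =
        c • h + PowerSeries.X * (h * q * Q.subst (PowerSeries.X * q)) := by
    rw [subst_C_add_X_mul hs, Algebra.smul_def]
    ring
  induction n generalizing h P with
  | zero =>
    obtain ⟨c, Q, rfl⟩ := exists_eq_C_add_X_mul P
    simp [hHorner]
  | succ n ih =>
    obtain ⟨c, Q, rfl⟩ := exists_eq_C_add_X_mul P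
    rw [hHorner, map_add, PowerSeries.coeff_succ_X_mul, ih,
      Finset.sum_range_succ' _ (n + 1), add_comm]
    simp [PowerSeries.coeff_succ_X_mul, pow_succ', mul_assoc]

end Substitution

section RenormalizationGroup

variable {R A : Type*} [CommRing R] [CommRing A] [Algebra R A]

/-- The derivation `∂ - r γ(x) x d/dx` of `A⟦x⟧`, where `∂` is the coefficientwise action of `D`. -/
noncomputable def rgDerivation (D : Derivation R A A) (r : ℤ) (γ : R⟦X⟧) :
    Derivation R A⟦X⟧ A⟦X⟧ :=
  coeffwiseDerivation D -
    ((r : A⟦X⟧) * PowerSeries.map (algebraMap R A) γ) • (euler A).restrictScalars R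

/-- The renormalization group operator `∂ - γ(x) (1 + r x d/dx)`. -/
noncomputable def rgOperator (D : Derivation R A A) (r : ℤ) (γ : R⟦X⟧) : A⟦X⟧ →ₗ[R] A⟦X⟧ :=
  (rgDerivation D r γ : A⟦X⟧ →ₗ[R] A⟦X⟧) -
    LinearMap.mulLeft R (PowerSeries.map (algebraMap R A) γ)

theorem rgOperator_apply (D : Derivation R A A) (r : ℤ) (γ : R⟦X⟧) (f : A⟦X⟧) :
    rgOperator D r γ f = coeffwiseDerivation D f -
      PowerSeries.map (algebraMap R A) γ * (f + r * euler A f) := by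
  simp only [rgOperator, rgDerivation, LinearMap.sub_apply, LinearMap.mulLeft_apply,
    Derivation.coeFn_coe, Derivation.sub_apply, Derivation.smul_apply,
    Derivation.restrictScalars_apply, smul_eq_mul]
  ring

theorem coeffwiseDerivation_rgOperator (D : Derivation R A A) (r : ℤ) (γ : R⟦X⟧) (f : A⟦X⟧) :
    coeffwiseDerivation D (rgOperator D r γ f) =
      rgOperator D r γ (coeffwiseDerivation D f) := by
  simp [rgOperator_apply, coeffwiseDerivation_euler, coeffwiseDerivation_map_algebraMap]

theorem rgDerivation_X (D : Derivation R A A) (r : ℤ) (γ : R⟦X⟧) :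
    rgDerivation D r γ PowerSeries.X =
      -((r : A⟦X⟧) * PowerSeries.map (algebraMap R A) γ * PowerSeries.X) := by
  have hX : coeffwiseDerivation D (PowerSeries.X : A⟦X⟧) = 0 := by
    ext n
    rw [coeff_coeffwiseDerivation, PowerSeries.coeff_X]
    split_ifs <;> simp
  simp [rgDerivation, hX, euler]

/-- The invariant charge `x g(x)^r`, the argument at which a Dyson–Schwinger equation evaluates its
vertex series. -/
noncomputable def invariantCharge (r : ℤ) (g : A⟦X⟧ˣ) : A⟦X⟧ :=
  PowerSeries.X * ((g ^ r : A⟦X⟧ˣ) : A⟦X⟧)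

theorem X_dvd_invariantCharge (r : ℤ) (g : A⟦X⟧ˣ) : PowerSeries.X ∣ invariantCharge r g :=
  dvd_mul_right _ _

theorem rgDerivation_invariantCharge_mul (D : Derivation R A A) (r : ℤ) (γ : R⟦X⟧) (g : A⟦X⟧ˣ) :
    rgDerivation D r γ (invariantCharge r g) * g =
      (r : A⟦X⟧) * invariantCharge r g * rgOperator D r γ g := by
  have hpow := derivation_units_zpow (rgDerivation D r γ) g r
  simp only [invariantCharge, Derivation.leibniz, rgDerivation_X, smul_eq_mul, rgOperator,
    LinearMap.sub_apply, LinearMap.mulLeft_apply, Derivation.coeFn_coe]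
  linear_combination PowerSeries.X * hpow

theorem rgOperator_mul_subst (D : Derivation R A A) (r : ℤ) (γ : R⟦X⟧) (g : A⟦X⟧ˣ) (P : R⟦X⟧) :
    rgOperator D r γ ((g : A⟦X⟧) * P.subst (invariantCharge r g)) =
      (P.subst (invariantCharge r g) + (r : A⟦X⟧) * invariantCharge r g *
        (PowerSeries.derivative R P).subst (invariantCharge r g)) * rgOperator D r γ g := by
  have hcharge := rgDerivation_invariantCharge_mul D r γ g
  have hsubst := derivation_subst (rgDerivation D r γ) (X_dvd_invariantCharge r g) P
  simp only [rgOperator, LinearMap.sub_apply, LinearMap.mulLeft_apply, Derivation.coeFn_coe,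
    Derivation.leibniz, smul_eq_mul] at hcharge ⊢
  rw [hsubst]
  linear_combination (PowerSeries.derivative R P).subst (invariantCharge r g) * hcharge

end RenormalizationGroup

section AnomalousDimension

variable {K : Type*} [CommRing K]

/-- Setting `L = 0` in a power series over `K[L]`. -/
noncomputable def evalZero (K : Type*) [CommRing K] : K[X]⟦X⟧ →ₐ[K] K⟦X⟧ :=
  PowerSeries.mapAlgHom (Polynomial.aeval (0 : K))

@[simp]
theorem coeff_evalZero (f : K[X]⟦X⟧) (n : ℕ) : coeff n (evalZero K f) = (coeff n f).coeff 0 := by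
  simp [evalZero, PowerSeries.mapAlgHom_apply, Polynomial.coeff_zero_eq_eval_zero]

theorem evalZero_map_algebraMap (f : K⟦X⟧) :
    evalZero K (PowerSeries.map (algebraMap K K[X]) f) = f := by
  ext n
  simp

theorem evalZero_euler (f : K[X]⟦X⟧) : evalZero K (euler K[X] f) = euler K (evalZero K f) :=
  map_euler _ f

/-- The coefficientwise derivation `∂_L` on power series over `K[L]`. -/
noncomputable abbrev derivL (K : Type*) [CommRing K] : Derivation K K[X]⟦X⟧ K[X]⟦X⟧ :=
  coeffwiseDerivation Polynomial.derivative'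

theorem polynomial_eq_zero_of_derivative_add_derivative [IsAddTorsionFree K] {a : K[X]}
    (h : a.derivative + a.derivative.derivative = 0) (h0 : a.coeff 0 = 0) : a = 0 := by
  have hd : a.derivative = 0 := by
    by_contra hne
    have hlt := Polynomial.degree_derivative_lt hne
    rw [← neg_eq_of_add_eq_zero_right h, Polynomial.degree_neg] at hlt
    exact hlt.false
  rw [Polynomial.eq_C_of_derivative_eq_zero hd, h0, Polynomial.C_0]

theorem eq_zero_of_derivL_add_derivL_eq_mul [IsAddTorsionFree K] {f M : K[X]⟦X⟧}
    (hM : PowerSeries.X ∣ M) (hf : derivL K f + derivL K (derivL K f) = M * f)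
    (hf0 : evalZero K f = 0) : f = 0 := by
  refine eq_of_forall_X_pow_dvd_sub fun n => ?_
  rw [sub_zero]
  induction n with
  | zero => simp
  | succ n ih =>
    have hdvd : PowerSeries.X ^ (n + 1) ∣ derivL K f + derivL K (derivL K f) := by
      rw [hf, pow_succ']
      exact mul_dvd_mul hM ih
    rw [PowerSeries.X_pow_dvd_iff] at hdvd ⊢
    intro m hm
    refine polynomial_eq_zero_of_derivative_add_derivative ?_ ?_
    · simpa using hdvd m hm
    · rw [← coeff_evalZero, hf0, map_zero]

theorem rgOperator_eq_zero [IsAddTorsionFree K] (r : ℤ) {P : K⟦X⟧} (hP : constantCoeff P = 0)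
    (g : K[X]⟦X⟧ˣ)
    (hg : derivL K g + derivL K (derivL K g) =
      (g : K[X]⟦X⟧) * P.subst (invariantCharge r g))
    (hg0 : evalZero K g = 1) :
    rgOperator Polynomial.derivative' r (evalZero K (derivL K g)) (g : K[X]⟦X⟧) = 0 := by
  refine eq_zero_of_derivL_add_derivL_eq_mul (M := P.subst (invariantCharge r g) +
    (r : K[X]⟦X⟧) * invariantCharge r g *
      (PowerSeries.derivative K P).subst (invariantCharge r g)) ?_ ?_ ?_
  · exact dvd_add (X_dvd_subst (X_dvd_invariantCharge r g) hP)
      (((X_dvd_invariantCharge r g).mul_left _).mul_right _)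
  · rw [coeffwiseDerivation_rgOperator, coeffwiseDerivation_rgOperator, ← map_add, hg,
      rgOperator_mul_subst]
  · rw [rgOperator_apply, map_sub, map_mul, map_add, map_mul, evalZero_euler, hg0,
      evalZero_map_algebraMap]
    simp

theorem anomalousDimension_equation [IsAddTorsionFree K] (r : ℤ) {P : K⟦X⟧}
    (hP : constantCoeff P = 0) (g : K[X]⟦X⟧ˣ)
    (hg : derivL K g + derivL K (derivL K g) =
      (g : K[X]⟦X⟧) * P.subst (invariantCharge r g))
    (hg0 : evalZero K g = 1) {γ : K⟦X⟧} (hγ : evalZero K (derivL K g) = γ) :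
    γ + γ * (γ + (r : K⟦X⟧) * euler K γ) = P := by
  have hsecond : evalZero K (derivL K (derivL K g)) = γ * (γ + (r : K⟦X⟧) * euler K γ) := by
    have hrg := rgOperator_eq_zero r hP g hg hg0
    have hD := congrArg (fun f => evalZero K (derivL K f)) hrg
    rw [coeffwiseDerivation_rgOperator, rgOperator_apply] at hD
    simpa only [map_sub, map_mul, map_add, map_intCast, map_zero, evalZero_euler,
      evalZero_map_algebraMap, hγ, sub_eq_zero] using hD
  have hcharge : evalZero K (invariantCharge r g) = PowerSeries.X := by
    have hunit : Units.map (evalZero K : K[X]⟦X⟧ →* K⟦X⟧) g = 1 := Units.ext hg0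
    have hpow : Units.map (evalZero K : K[X]⟦X⟧ →* K⟦X⟧) (g ^ r) = 1 := by
      rw [map_zpow, hunit, one_zpow]
    have hval : evalZero K ((g ^ r : K[X]⟦X⟧ˣ) : K[X]⟦X⟧) = 1 := congrArg Units.val hpow
    have hX : evalZero K PowerSeries.X = PowerSeries.X := PowerSeries.map_X _
    rw [invariantCharge, map_mul, hX, hval, mul_one]
  calc γ + γ * (γ + (r : K⟦X⟧) * euler K γ)
      = evalZero K (derivL K g + derivL K (derivL K g)) := by rw [map_add, hγ, hsecond]
    _ = P.subst (evalZero K (invariantCharge r g)) := by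
      rw [hg, map_mul, hg0, one_mul, algHom_subst _ (X_dvd_invariantCharge r g) hcharge.symm.dvd]
    _ = P := by rw [hcharge, PowerSeries.X_subst]

theorem coeff_mul_add_euler {γ : K⟦X⟧} (hγ : coeff 0 γ = 0) (r : ℤ) {n : ℕ} (hn : 1 ≤ n) :
    coeff n (γ * (γ + (r : K⟦X⟧) * euler K γ)) =
      ∑ j ∈ Finset.Ico 1 n, (r * j + 1) * coeff j γ * coeff (n - j) γ := by
  have hcoeff (j : ℕ) : coeff j (γ + (r : K⟦X⟧) * euler K γ) = (r * j + 1) * coeff j γ := by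
    rw [map_add, ← map_intCast (PowerSeries.C : K →+* K⟦X⟧), PowerSeries.coeff_C_mul, coeff_euler]
    ring
  rw [mul_comm, PowerSeries.coeff_mul, Finset.Nat.sum_antidiagonal_eq_sum_range_succ_mk,
    Finset.sum_range_succ, Finset.range_eq_Ico, Finset.sum_eq_sum_Ico_succ_bot hn]
  simp only [hcoeff, hγ, Nat.sub_self, mul_zero, zero_mul, zero_add, add_zero]

end AnomalousDimension

section LaurentSeries

variable {R V W : Type*} [CommRing R] [AddCommGroup V] [Module R V] [AddCommGroup W] [Module R W]

/-- The evaluation `a(∂_{-ρ}) f |_{ρ = 0}` of a Laurent series `f` in `ρ`, with `∂_{-ρ} = -∂/∂ρ`;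
at a pole, `|_{ρ = 0}` picks the constant coefficient. -/
noncomputable def evalNegDeriv (a : R[X]) : LaurentSeries V →ₗ[R] V :=
  HahnSeries.coeff.linearMap (0 : ℤ) ∘ₗ
    Polynomial.aeval (-(LaurentSeries.derivative R) : Module.End R (LaurentSeries V)) a

theorem evalNegDeriv_eq_sum (a : R[X]) (f : LaurentSeries V) :
    evalNegDeriv a f = a.sum fun n c => (c * ((-1) ^ n * (n.factorial : R))) • f.coeff n := by
  have hcoeff (n : ℕ) : (((-(LaurentSeries.derivative R) : Module.End R (LaurentSeries V)) ^ n)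
      f).coeff 0 = ((-1) ^ n * (n.factorial : R)) • f.coeff n := by
    rw [← neg_one_smul R (LaurentSeries.derivative R), _root_.smul_pow, LinearMap.smul_apply,
      Module.End.pow_apply, LaurentSeries.derivative_iterate, HahnSeries.coeff_smul,
      HahnSeries.coeff_nsmul, Pi.smul_apply, LaurentSeries.hasseDeriv_coeff, zero_add,
      Ring.choose_natCast, Nat.choose_self, Nat.cast_one, one_smul, mul_smul,
      Nat.cast_smul_eq_nsmul]
  simp [evalNegDeriv, Polynomial.aeval_eq_sum_range, Polynomial.sum_over_range, hcoeff, mul_smul]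

theorem map_evalNegDeriv (φ : V →ₗ[R] W) (a : R[X]) (f : LaurentSeries V) :
    φ (evalNegDeriv a f) = evalNegDeriv a (f.map φ) := by
  simp [evalNegDeriv_eq_sum, Polynomial.sum_def]

/-- The ring homomorphism on Laurent series applying `φ` to the coefficients. -/
def laurentMap {A B : Type*} [CommRing A] [CommRing B] (φ : A →+* B) :
    LaurentSeries A →+* LaurentSeries B where
  toFun f := f.map φ
  map_one' := HahnSeries.map_one φ.toMonoidWithZeroHom
  map_mul' _ _ := HahnSeries.map_mul φ.toNonUnitalRingHom
  map_zero' := by ext; simp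
  map_add' _ _ := HahnSeries.map_add φ.toAddMonoidHom

@[simp]
theorem coeff_laurentMap {A B : Type*} [CommRing A] [CommRing B] (φ : A →+* B)
    (f : LaurentSeries A) (n : ℤ) : (laurentMap φ f).coeff n = φ (f.coeff n) :=
  rfl

theorem map_ofPowerSeries {A B F : Type*} [CommRing A] [CommRing B] [FunLike F A B]
    [ZeroHomClass F A B] (φ : F) (f : A⟦X⟧) :
    (HahnSeries.ofPowerSeries ℤ A f).map φ =
      HahnSeries.ofPowerSeries ℤ B (PowerSeries.mk fun n => φ (coeff n f)) := by
  ext n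
  rw [HahnSeries.map_coeff, PowerSeries.coeff_coe, PowerSeries.coeff_coe, PowerSeries.coeff_mk]
  split_ifs
  · exact map_zero φ
  · rfl

theorem smul_eq_laurentMap_C_mul (c : R) (f : LaurentSeries R[X]) :
    c • f = laurentMap Polynomial.C (HahnSeries.C c) * f := by
  have hC : laurentMap Polynomial.C (HahnSeries.C c) =
      (HahnSeries.C (Polynomial.C c) : LaurentSeries R[X]) :=
    HahnSeries.map_C c Polynomial.C
  rw [hC, HahnSeries.C_mul_eq_smul]
  ext n
  simp [Polynomial.smul_eq_C_mul]

/-- The coefficientwise derivation `∂_L` on Laurent series in `ρ` over `R[L]`. -/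
noncomputable def laurentDerivL (R : Type*) [CommRing R] :
    LaurentSeries R[X] →ₗ[R] LaurentSeries R[X] where
  toFun f := f.map (Polynomial.derivative : R[X] →ₗ[R] R[X])
  map_add' f g := by ext; simp
  map_smul' c f := by ext; simp

@[simp]
theorem coeff_laurentDerivL (f : LaurentSeries R[X]) (n : ℤ) :
    (laurentDerivL R f).coeff n = (f.coeff n).derivative :=
  rfl

theorem derivative_evalNegDeriv (a : R[X]) (f : LaurentSeries R[X]) :
    (evalNegDeriv a f).derivative = evalNegDeriv a (laurentDerivL R f) :=
  map_evalNegDeriv Polynomial.derivative a f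

theorem laurentDerivL_one : laurentDerivL R 1 = 0 := by
  ext1
  funext n
  rw [coeff_laurentDerivL, HahnSeries.coeff_one]
  split_ifs <;> simp

theorem laurentDerivL_laurentMap_C_mul (f : LaurentSeries R) (g : LaurentSeries R[X]) :
    laurentDerivL R (laurentMap Polynomial.C f * g) =
      laurentMap Polynomial.C f * laurentDerivL R g := by
  ext1
  funext n
  have hsupp : (laurentDerivL R g).support ⊆ g.support := fun i hi hg => hi (by simp [hg])
  rw [coeff_laurentDerivL, HahnSeries.coeff_mul, HahnSeries.coeff_mul_right' g.isPWO_support hsupp]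
  simp [Polynomial.derivative_mul]

end LaurentSeries

section Insertion

variable {K : Type*} [Field K]

/-- The kernel `F(ρ) (e^{-Lρ} - 1)` of the insertion with Mellin transform `F`. -/
noncomputable def mellinKernel (F : LaurentSeries K) : LaurentSeries K[X] :=
  laurentMap Polynomial.C F * (expNegL K - 1)

theorem insertion_eq_evalNegDeriv (F : LaurentSeries K) (a : K[X]) :
    insertion F a = evalNegDeriv a (mellinKernel F) :=
  rfl

theorem coeff_expNegL (n : ℕ) :
    (expNegL K).coeff n = (n.factorial : K)⁻¹ • (-Polynomial.X) ^ n := by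
  rw [expNegL, HahnSeries.ofPowerSeries_apply_coeff, PowerSeries.coeff_mk]

theorem evalNegDeriv_expNegL [CharZero K] (a : K[X]) : evalNegDeriv a (expNegL K) = a := by
  have hterm (n : ℕ) (c : K) :
      (c * ((-1) ^ n * (n.factorial : K))) • (expNegL K).coeff n = Polynomial.monomial n c := by
    have hn := Nat.cast_ne_zero (R := K).2 n.factorial_ne_zero
    have hX : (-Polynomial.X : K[X]) ^ n = (-1 : K) ^ n • Polynomial.X ^ n := by
      rw [← neg_one_smul K, _root_.smul_pow]
    have hsign : (-1 : K) ^ n * (-1) ^ n = 1 := by rw [← mul_pow]; simp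
    rw [coeff_expNegL, hX, smul_smul, smul_smul, ← Polynomial.smul_X_eq_monomial]
    congr 1
    field_simp
    linear_combination c * hsign
  simp only [evalNegDeriv_eq_sum, hterm]
  exact Polynomial.sum_monomial_eq a

theorem coeff_zero_insertion (F : LaurentSeries K) (a : K[X]) : (insertion F a).coeff 0 = 0 := by
  have hE : laurentMap Polynomial.constantCoeff (expNegL K) = 1 := by
    refine (map_ofPowerSeries _ _).trans
      ((congrArg (HahnSeries.ofPowerSeries ℤ K) ?_).trans (map_one _))
    ext n
    cases n <;> simp [PowerSeries.coeff_one, Polynomial.coeff_zero_eq_eval_zero]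
  have hS : laurentMap Polynomial.constantCoeff (mellinKernel F) = 0 := by
    rw [mellinKernel, map_mul, map_sub, map_one, hE, sub_self, mul_zero]
  rw [insertion_eq_evalNegDeriv, ← Polynomial.lcoeff_apply, map_evalNegDeriv]
  exact (congrArg (evalNegDeriv a) hS).trans (map_zero _)

theorem laurentDerivL_expNegL [CharZero K] :
    laurentDerivL K (expNegL K) = -(HahnSeries.single (1 : ℤ) (1 : K[X]) * expNegL K) := by
  refine (map_ofPowerSeries Polynomial.derivative _).trans ?_
  rw [expNegL, ← HahnSeries.ofPowerSeries_X, ← map_mul, ← map_neg]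
  congr 1
  ext1 n
  cases n with
  | zero => simp
  | succ n =>
    have hfact : ((n + 1).factorial : K)⁻¹ * ((n : K) + 1) = (n.factorial : K)⁻¹ := by
      have := Nat.cast_add_one_ne_zero (R := K) n
      have := Nat.cast_ne_zero (R := K).2 n.factorial_ne_zero
      rw [Nat.factorial_succ]
      push_cast
      field_simp
    rw [PowerSeries.coeff_mk, PowerSeries.coeff_mk, Polynomial.derivative_smul, map_neg,
      PowerSeries.coeff_succ_X_mul, PowerSeries.coeff_mk, Polynomial.derivative_pow_succ, ← hfact,
      mul_smul]
    simp [Polynomial.smul_eq_C_mul]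

theorem laurentDerivL_laurentMap_C_mul_expNegL [CharZero K] (f : LaurentSeries K) :
    laurentDerivL K (laurentMap Polynomial.C f * expNegL K) =
      -(laurentMap Polynomial.C (HahnSeries.single (1 : ℤ) (1 : K) * f) * expNegL K) := by
  have hρ : laurentMap Polynomial.C (HahnSeries.single (1 : ℤ) (1 : K)) =
      HahnSeries.single (1 : ℤ) (1 : K[X]) :=
    HahnSeries.map_single (ZeroHomClass.toZeroHom (Polynomial.C : K →+* K[X]))
  rw [laurentDerivL_laurentMap_C_mul, laurentDerivL_expNegL, map_mul, hρ]
  ring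

theorem laurentDerivL_mellinKernel [CharZero K] (F : LaurentSeries K) :
    laurentDerivL K (mellinKernel F) =
      -(laurentMap Polynomial.C (HahnSeries.single (1 : ℤ) (1 : K) * F) * expNegL K) := by
  rw [mellinKernel, laurentDerivL_laurentMap_C_mul, map_sub, laurentDerivL_one, sub_zero,
    ← laurentDerivL_laurentMap_C_mul, laurentDerivL_laurentMap_C_mul_expNegL]

theorem laurentDerivL_add_laurentDerivL_mellinKernel [CharZero K] {F : LaurentSeries K} {c : K}
    (hF : (HahnSeries.single (1 : ℤ) (1 : K) : LaurentSeries K) * F =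
      HahnSeries.C c / (1 - HahnSeries.single (1 : ℤ) (1 : K))) :
    laurentDerivL K (mellinKernel F) + laurentDerivL K (laurentDerivL K (mellinKernel F)) =
      -(c • expNegL K) := by
  set ρ : LaurentSeries K := HahnSeries.single 1 1
  have hρ : 1 - ρ ≠ 0 := fun h => by
    simpa [ρ] using congrArg (fun f : LaurentSeries K => f.coeff 0) h
  have hc : ρ * F - ρ * (ρ * F) = HahnSeries.C c := by
    rw [← (eq_div_iff hρ).1 hF]
    ring
  rw [laurentDerivL_mellinKernel, map_neg, laurentDerivL_laurentMap_C_mul_expNegL,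
    smul_eq_laurentMap_C_mul, ← hc, map_sub]
  ring

theorem derivative_insertion [CharZero K] {F : LaurentSeries K} {c : K}
    (hF : (HahnSeries.single (1 : ℤ) (1 : K) : LaurentSeries K) * F =
      HahnSeries.C c / (1 - HahnSeries.single (1 : ℤ) (1 : K))) (a : K[X]) :
    (insertion F a).derivative + (insertion F a).derivative.derivative = -(c • a) := by
  rw [insertion_eq_evalNegDeriv, derivative_evalNegDeriv, derivative_evalNegDeriv, ← map_add,
    laurentDerivL_add_laurentDerivL_mellinKernel hF, map_neg, map_smul, evalNegDeriv_expNegL]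

end Insertion

section GreenFunction

variable {K : Type*} [Field K] {r : ℤ} {s : ℕ → ℕ} {p : ℕ → ℕ → K}
  {F : ℕ → ℕ → LaurentSeries K} {X : (TreeAlgebra K)⟦X⟧ˣ}

/-- The Green function `G(x, L)` as a unit, so that its powers `G^r` with `r : ℤ` make sense. -/
noncomputable def greenUnit (F : ℕ → ℕ → LaurentSeries K) (X : (TreeAlgebra K)⟦X⟧ˣ) : K[X]⟦X⟧ˣ :=
  Units.map (PowerSeries.map (feynmanRules F : TreeAlgebra K →+* K[X]) :
    (TreeAlgebra K)⟦X⟧ →* K[X]⟦X⟧) X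

/-- The series `P(x) = ∑_{k ≥ 1} (∑_{i ≤ s k} r_{k,i} p_i(k)) x^k` of weighted primitives. -/
noncomputable def primitiveSeries (s : ℕ → ℕ) (p res : ℕ → ℕ → K) : K⟦X⟧ :=
  PowerSeries.mk fun k => if k = 0 then 0 else ∑ i ∈ Finset.range (s k + 1), res k i * p i k

theorem constantCoeff_primitiveSeries (s : ℕ → ℕ) (p res : ℕ → ℕ → K) :
    constantCoeff (primitiveSeries s p res) = 0 := by
  rw [← PowerSeries.coeff_zero_eq_constantCoeff_apply, primitiveSeries, PowerSeries.coeff_mk,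
    if_pos rfl]

theorem coeff_primitiveSeries (s : ℕ → ℕ) (p res : ℕ → ℕ → K) {k : ℕ} (hk : 1 ≤ k) :
    coeff k (primitiveSeries s p res) = ∑ i ∈ Finset.range (s k + 1), res k i * p i k := by
  rw [primitiveSeries, PowerSeries.coeff_mk, if_neg (Nat.one_le_iff_ne_zero.1 hk)]

theorem feynmanRules_coeff_mul_zpow (F : ℕ → ℕ → LaurentSeries K) (X : (TreeAlgebra K)⟦X⟧ˣ)
    (r : ℤ) (k n : ℕ) :
    feynmanRules F (coeff n ((X * (X ^ r) ^ k : (TreeAlgebra K)⟦X⟧ˣ) : (TreeAlgebra K)⟦X⟧)) =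
      coeff n ((greenUnit F X * (greenUnit F X ^ r) ^ k : K[X]⟦X⟧ˣ) : K[X]⟦X⟧) := by
  rw [greenUnit, ← map_zpow, ← map_pow, ← map_mul]
  exact (PowerSeries.coeff_map _ _ _).symm

theorem coeff_greenUnit (hX : IsDSESolution r s p X) (F : ℕ → ℕ → LaurentSeries K) (n : ℕ) :
    coeff n (greenUnit F X : K[X]⟦X⟧) = coeff n (1 : K[X]⟦X⟧) -
      ∑ k ∈ Finset.Icc 1 n, ∑ i ∈ Finset.range (s k + 1), p i k • insertion (F k i)
        (coeff (n - k) ((greenUnit F X * (greenUnit F X ^ r) ^ k : K[X]⟦X⟧ˣ) : K[X]⟦X⟧)) := by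
  have hφ : coeff n (greenUnit F X : K[X]⟦X⟧) = feynmanRules F (coeff n X.val) :=
    PowerSeries.coeff_map (feynmanRules F : TreeAlgebra K →+* K[X]) n X.val
  rw [hφ, hX n]
  simp only [map_sub, map_sum, map_smul, feynmanRules_bPlus, feynmanRules_coeff_mul_zpow,
    PowerSeries.coeff_one, apply_ite (feynmanRules F), map_one, map_zero]

theorem evalZero_greenUnit (hX : IsDSESolution r s p X) (F : ℕ → ℕ → LaurentSeries K) :
    evalZero K (greenUnit F X) = 1 := by
  ext1 n
  rw [coeff_evalZero, coeff_greenUnit hX]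
  simp only [Polynomial.coeff_sub, Polynomial.finsetSum_coeff, Polynomial.coeff_smul,
    coeff_zero_insertion, smul_zero, Finset.sum_const_zero, sub_zero]
  rw [← coeff_evalZero, map_one]

theorem sum_smul_derivative_insertion [CharZero K] {res : ℕ → ℕ → K} {k : ℕ} (hk : 1 ≤ k)
    (hF : ∀ i ≤ s k, (HahnSeries.single (1 : ℤ) (1 : K) : LaurentSeries K) * F k i =
      HahnSeries.C (res k i) / (1 - HahnSeries.single (1 : ℤ) (1 : K))) (a : K[X]) :
    ∑ i ∈ Finset.range (s k + 1), p i k • ((insertion (F k i) a).derivative +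
      (insertion (F k i) a).derivative.derivative) =
        -(coeff k (primitiveSeries s p res) • a) := by
  rw [coeff_primitiveSeries s p res hk, Finset.sum_smul, ← Finset.sum_neg_distrib]
  refine Finset.sum_congr rfl fun i hi => ?_
  rw [derivative_insertion (hF i (Finset.mem_range_succ_iff.1 hi)), smul_neg, smul_smul, mul_comm]

theorem derivL_add_derivL_derivL_greenUnit [CharZero K] {res : ℕ → ℕ → K}
    (hF : ∀ k ≥ 1, ∀ i ≤ s k, (HahnSeries.single (1 : ℤ) (1 : K) : LaurentSeries K) * F k i =
      HahnSeries.C (res k i) / (1 - HahnSeries.single (1 : ℤ) (1 : K)))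
    (hX : IsDSESolution r s p X) :
    derivL K (greenUnit F X) + derivL K (derivL K (greenUnit F X)) =
      (greenUnit F X : K[X]⟦X⟧) *
        (primitiveSeries s p res).subst (invariantCharge r (greenUnit F X)) := by
  ext1 n
  have hone : Polynomial.derivative (coeff n (1 : K[X]⟦X⟧)) = 0 := by
    rw [PowerSeries.coeff_one]
    split_ifs <;> simp
  have hzero : coeff 0 (primitiveSeries s p res) = 0 := by
    rw [PowerSeries.coeff_zero_eq_constantCoeff_apply, constantCoeff_primitiveSeries]
  calc coeff n (derivL K (greenUnit F X) + derivL K (derivL K (greenUnit F X)))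
      = (coeff n (greenUnit F X : K[X]⟦X⟧)).derivative +
          (coeff n (greenUnit F X : K[X]⟦X⟧)).derivative.derivative := by simp
    _ = ∑ k ∈ Finset.Icc 1 n, coeff k (primitiveSeries s p res) • coeff (n - k)
          ((greenUnit F X * (greenUnit F X ^ r) ^ k : K[X]⟦X⟧ˣ) : K[X]⟦X⟧) := by
      rw [coeff_greenUnit hX]
      simp only [map_sub, hone, zero_sub, map_neg, map_sum, Polynomial.derivative_smul, ← neg_add,
        ← Finset.sum_add_distrib, ← smul_add]
      rw [← Finset.sum_neg_distrib]
      refine Finset.sum_congr rfl fun k hk => ?_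
      have hk1 := (Finset.mem_Icc.1 hk).1
      rw [sum_smul_derivative_insertion hk1 (hF k hk1), neg_neg]
    _ = _ := by
      rw [invariantCharge, coeff_mul_subst_X_mul, Finset.range_eq_Ico,
        Finset.sum_eq_sum_Ico_succ_bot n.succ_pos, hzero, zero_smul, zero_add]
      exact Finset.sum_congr (by ext; simp) fun k _ => by simp

theorem evalZero_derivL_greenUnit (F : ℕ → ℕ → LaurentSeries K) (X : (TreeAlgebra K)⟦X⟧ˣ) :
    evalZero K (derivL K (greenUnit F X)) = gamma F X 1 := by
  ext n
  simp [gamma, greenUnit, greenFunction, Polynomial.coeff_derivative]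

theorem coeff_zero_gamma_one (hX : IsDSESolution r s p X) (F : ℕ → ℕ → LaurentSeries K) :
    coeff 0 (gamma F X 1) = 0 := by
  rw [← evalZero_derivL_greenUnit, coeff_evalZero, coeff_coeffwiseDerivation, coeff_greenUnit hX]
  simp

end GreenFunction

end DysonSchwinger

theorem mainTheorem4 {K : Type*} [Field K] [CharZero K] (r : ℤ) (s : ℕ → ℕ) (p : ℕ → ℕ → K)
    (F : ℕ → ℕ → LaurentSeries K) (res : ℕ → ℕ → K)
    (hF : ∀ k ≥ 1, ∀ i ≤ s k, (HahnSeries.single (1 : ℤ) (1 : K) : LaurentSeries K) * F k i =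
      HahnSeries.C (res k i) / (1 - HahnSeries.single (1 : ℤ) (1 : K)))
    (X : (PowerSeries (DysonSchwinger.TreeAlgebra K))ˣ)
    (hX : DysonSchwinger.IsDSESolution r s p X) :
    PowerSeries.coeff 0 (DysonSchwinger.gamma F X 1) = 0 ∧
    ∀ n ≥ 1, PowerSeries.coeff n (DysonSchwinger.gamma F X 1) =
      ∑ i ∈ Finset.range (s n + 1), res n i * p i n +
        ∑ j ∈ Finset.Ico 1 n, (-(r : K) * (j : K) - 1) *
          PowerSeries.coeff j (DysonSchwinger.gamma F X 1) *
          PowerSeries.coeff (n - j) (DysonSchwinger.gamma F X 1) := by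
  have hγ0 := DysonSchwinger.coeff_zero_gamma_one hX F
  refine ⟨hγ0, fun n hn => ?_⟩
  have hγ := DysonSchwinger.anomalousDimension_equation r
    (DysonSchwinger.constantCoeff_primitiveSeries s p res) (DysonSchwinger.greenUnit F X)
    (DysonSchwinger.derivL_add_derivL_derivL_greenUnit hF hX)
    (DysonSchwinger.evalZero_greenUnit hX F) (DysonSchwinger.evalZero_derivL_greenUnit F X)
  have hcoeff := congrArg (PowerSeries.coeff n) hγ
  rw [map_add, DysonSchwinger.coeff_mul_add_euler hγ0 r hn,
    DysonSchwinger.coeff_primitiveSeries s p res hn] at hcoeff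
  rw [← hcoeff, add_assoc, left_eq_add, ← Finset.sum_add_distrib]
  exact Finset.sum_eq_zero fun j _ => by ring
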